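/- Let $k$ be a field and let $\mathcal{A}$ be an essentially small additive category which is $k$-trivial: for all objects $x,y$ of $\mathcal{A}$ the abelian group $\mathcal{A}(x,y)$ is finite, of order invertible in $k$. Let $\mathcal{F}(\mathcal{A};k)$ be the category of all (not necessarily additive) functors from $\mathcal{A}$ to $k$-vector spaces, with the pointwise tensor product over $k$, $(F\otimes G)(a)=F(a)\otimes_k G(a)$. For an object $x$ of $\mathcal{A}$ and $F$ in $\mathcal{F}(\mathcal{A};k)$, let $\tau_x(F)=F(x\oplus -)$, and let $\bar\tau_x(F)$ be the quotient functor of $\tau_x(F)$ given by the coinvariants $$\bar\tau_x(F)(a)=F(x\oplus a)_{\mathcal{A}(x,a)},$$ where $u\in\mathcal{A}(x,a)$ acts through the automorphism $\begin{pmatrix}\mathrm{Id}_x&0\\u&\mathrm{Id}_a\end{pmatrix}$ of $x\oplus a$. Let $\bar\delta_x(F)$ be the cokernel of the natural morphism $F\to\bar\tau_x(F)$ induced by the inclusions $a\to x\oplus a$. For $d\in\mathbb{N}$, let $\mathcal{F}_d(\mathcal{A};k)$ be the full subcategory of $\mathcal{F}(\mathcal{A};k)$ of those functors $F$ such that $$\bar\delta_{a_0}\cdots\bar\delta_{a_d}\,\tau_x(F)=0\quad\text{for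 all objects } a_0,\dots,a_d,x \text{ of } \mathcal{A}.$$ Let $n,m\in\mathbb{N}$, let $F$ belong to $\mathcal{F}_n(\mathcal{A};k)$ and $G$ to $\mathcal{F}_m(\mathcal{A};k)$. Then $F\otimes G$ belongs to $\mathcal{F}_{n+m}(\mathcal{A};k)$. -/

import Mathlib

open CategoryTheory CategoryTheory.Limits
open scoped MonoidalCategory

universe w v u

namespace ParabolicFunctors

variable (k : Type w) [Field k]
variable (C : Type u) [Category.{v} C] [Preadditive C]

/-- A preadditive category is `k`-trivial if all its morphism groups are finite, of order
invertible in the field `k`. -/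
structure IsKTrivial : Prop where
  finite_hom : ∀ x y : C, Finite (x ⟶ y)
  isUnit_card : ∀ x y : C, IsUnit (Nat.card (x ⟶ y) : k)

variable {k C} [HasBinaryBiproducts C]

/-- The endofunctor `x ⊕ -` of an additive category. -/
@[simps]
noncomputable def addLeft (x : C) : C ⥤ C where
  obj a := x ⊞ a
  map f := biprod.map (𝟙 x) f

variable (k) in
/-- The shift functor `τ_x`: precomposition with `x ⊕ -`. -/
noncomputable def tau (x : C) : (C ⥤ ModuleCat.{w} k) ⥤ (C ⥤ ModuleCat.{w} k) :=
  (Functor.whiskeringLeft C C (ModuleCat.{w} k)).obj (addLeft x)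

/-- The action of the abelian group `Hom(x, a)` on `F (x ⊕ a)`, in which `u : x ⟶ a` acts by
the automorphism of `x ⊕ a` with components `id : x ⟶ x`, `u : x ⟶ a`, `0 : a ⟶ x`,
`id : a ⟶ a`. -/
noncomputable def shearRep (F : C ⥤ ModuleCat.{w} k) (x a : C) :
    Representation k (Multiplicative (x ⟶ a)) (F.obj (x ⊞ a)) where
  toFun u := (F.map (Biprod.unipotentUpper u.toAdd).hom).hom
  map_one' := by
    have h : (Biprod.unipotentUpper (0 : x ⟶ a)).hom = 𝟙 (x ⊞ a) := by
      ext <;> simp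
    simp only [toAdd_one, h, F.map_id]
    rfl
  map_mul' u u' := by
    have h : (Biprod.unipotentUpper (u.toAdd + u'.toAdd)).hom =
        (Biprod.unipotentUpper u'.toAdd).hom ≫ (Biprod.unipotentUpper u.toAdd).hom := by
      simp
    simp only [toAdd_mul, h, F.map_comp]
    rfl

lemma unipotentUpper_map {x a b : C} (f : a ⟶ b) (u : x ⟶ a) :
    (Biprod.unipotentUpper u).hom ≫ biprod.map (𝟙 x) f =
      biprod.map (𝟙 x) f ≫ (Biprod.unipotentUpper (u ≫ f)).hom := by
  ext <;> simp [Biprod.ofComponents]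

lemma shearRep_map (F : C ⥤ ModuleCat.{w} k) (x : C) {a b : C} (f : a ⟶ b) (u : x ⟶ a) :
    (F.map (biprod.map (𝟙 x) f)).hom ∘ₗ shearRep F x a (Multiplicative.ofAdd u) =
      shearRep F x b (Multiplicative.ofAdd (u ≫ f)) ∘ₗ (F.map (biprod.map (𝟙 x) f)).hom := by
  have h := congrArg (fun g => (F.map g).hom) (unipotentUpper_map f u)
  simp only [F.map_comp, ModuleCat.hom_comp] at h
  exact h

lemma shearRep_app {F G : C ⥤ ModuleCat.{w} k} (α : F ⟶ G) (x a : C)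
    (u : Multiplicative (x ⟶ a)) :
    (α.app (x ⊞ a)).hom ∘ₗ shearRep F x a u = shearRep G x a u ∘ₗ (α.app (x ⊞ a)).hom := by
  have h := congrArg ModuleCat.Hom.hom (α.naturality (Biprod.unipotentUpper u.toAdd).hom)
  simp only [ModuleCat.hom_comp] at h
  exact h

/-- The functor `a ↦ F (x ⊕ a)_{Hom(x, a)}` (coinvariants). -/
noncomputable def tauBarObj (x : C) (F : C ⥤ ModuleCat.{w} k) : C ⥤ ModuleCat.{w} k where
  obj a := ModuleCat.of k (shearRep F x a).Coinvariants
  map {a b} f := ModuleCat.ofHom <| Representation.Coinvariants.lift _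
    (Representation.Coinvariants.mk (shearRep F x b) ∘ₗ (F.map (biprod.map (𝟙 x) f)).hom)
    (fun u => by
      rw [LinearMap.comp_assoc]
      erw [shearRep_map F x f u.toAdd]
      ext y
      simp)
  map_id a := by
    have h : biprod.map (𝟙 x) (𝟙 a) = 𝟙 (x ⊞ a) := by
      ext <;> simp
    apply ModuleCat.hom_ext
    apply Representation.Coinvariants.hom_ext
    ext y
    simp [h]
  map_comp {a b c} f g := by
    have h : biprod.map (𝟙 x) (f ≫ g) = biprod.map (𝟙 x) f ≫ biprod.map (𝟙 x) g := by
      ext <;> simp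
    apply ModuleCat.hom_ext
    apply Representation.Coinvariants.hom_ext
    ext y
    simp [h]

variable (k) in
/-- The parabolic shift functor `τ̄_x`. -/
noncomputable def tauBar (x : C) : (C ⥤ ModuleCat.{w} k) ⥤ (C ⥤ ModuleCat.{w} k) where
  obj F := tauBarObj x F
  map {F G} α :=
    { app := fun a => ModuleCat.ofHom <| Representation.Coinvariants.map _ _
        { toLinearMap := (α.app (x ⊞ a)).hom
          isIntertwining' := shearRep_app α x a }
      naturality := fun a b f => by
        apply ModuleCat.hom_ext
        apply Representation.Coinvariants.hom_ext
        ext y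
        have h := congrArg (fun g => g.hom y) (α.naturality (biprod.map (𝟙 x) f))
        simp only [ModuleCat.hom_comp, LinearMap.comp_apply] at h
        exact congrArg (Representation.Coinvariants.mk (shearRep G x b)) h }
  map_id F := by
    ext a : 2
    apply ModuleCat.hom_ext
    apply Representation.Coinvariants.hom_ext
    ext y
    rfl
  map_comp α β := by
    ext a : 2
    apply ModuleCat.hom_ext
    apply Representation.Coinvariants.hom_ext
    ext y
    rfl

variable (k) in
/-- The canonical projection `τ_x ⟶ τ̄_x`. -/
noncomputable def tauToTauBar (x : C) : tau k x ⟶ tauBar k x where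
  app F :=
    { app := fun a => ModuleCat.ofHom (Representation.Coinvariants.mk (shearRep F x a))
      naturality := fun _ _ _ => rfl }
  naturality _ _ _ := rfl

variable (k) in
/-- The natural transformation `Id ⟶ τ_x` given by the inclusions `a ⟶ x ⊕ a`. -/
noncomputable def idToTau (x : C) : 𝟭 (C ⥤ ModuleCat.{w} k) ⟶ tau k x where
  app F :=
    { app := fun a => F.map biprod.inr
      naturality := fun a b f => by
        change F.map f ≫ F.map biprod.inr = F.map biprod.inr ≫ F.map (biprod.map (𝟙 x) f)
        rw [← F.map_comp, ← F.map_comp, biprod.inr_map] }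
  naturality F G α := by
    ext a : 2
    exact (α.naturality biprod.inr).symm

variable (k) in
/-- The natural transformation `Id ⟶ τ̄_x`. -/
noncomputable def idToTauBar (x : C) : 𝟭 (C ⥤ ModuleCat.{w} k) ⟶ tauBar k x :=
  idToTau k x ≫ tauToTauBar k x

variable (k) in
/-- The parabolic difference functor `δ̄_x`: the cokernel of `Id ⟶ τ̄_x`. -/
noncomputable def deltaBar (x : C) : (C ⥤ ModuleCat.{w} k) ⥤ (C ⥤ ModuleCat.{w} k) where
  obj F := cokernel ((idToTauBar k x).app F)
  map {F G} α := cokernel.map _ _ α ((tauBar k x).map α) ((idToTauBar k x).naturality α).symm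
  map_id F := by
    rw [← cancel_epi (cokernel.π _)]
    simp
  map_comp α β := by
    rw [← cancel_epi (cokernel.π _)]
    simp

variable (k) in
/-- The composite `δ̄_{a₀} ⋯ δ̄_{a_r}` associated with the list `[a₀, …, a_r]`
(`δ̄_{a_r}` is applied first). -/
noncomputable def deltaBarIter :
    List C → ((C ⥤ ModuleCat.{w} k) ⥤ (C ⥤ ModuleCat.{w} k))
  | [] => 𝟭 _
  | a :: l => deltaBarIter l ⋙ deltaBar k a

variable (k C) in
/-- The full subcategory `𝓕_d(C; k)` of the category of functors from `C` to `k`-vector spaces: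
those `F` such that `δ̄_{a₀} ⋯ δ̄_{a_d} τ_x F = 0` for all objects `a₀, …, a_d, x` of `C`. -/
def IsInF (d : ℕ) : ObjectProperty (C ⥤ ModuleCat.{w} k) := fun F =>
  ∀ (a : Fin (d + 1) → C) (x : C), IsZero ((deltaBarIter k (List.ofFn a)).obj ((tau k x).obj F))

end ParabolicFunctors

/-! The proof is Fourier analysis on the finite groups `Hom(y, P)`, with values in an algebraic
closure `K` of `k`, where their orders are invertible and characters therefore separate points. A
functor `F` is seen through its matrix coefficients `v ↦ ℓ (F v z)`. A character `χ` of `Hom(y, P)`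
generates, by restriction along maps into `P`, a subfunctor of `a ↦ Hom(y, a)^∨`; its depth (`Deep`)
is measured by strict chains there. The key dictionary, `deltaBarVanishes_iff_fourierVanishes`, says
that `F` lies in `𝓕_d` iff all its matrix coefficients have zero Fourier coefficient at every
character of depth at least `d + 1`.

Tensoring multiplies matrix coefficients, hence convolves their Fourier transforms. Depth is
subadditive (`Deep.of_mul`): if `χ * χ'` has depth at least `n + m + 1`, then `χ` has depth at least
`n + 1` or `χ'` has depth at least `m + 1`. So every term of the convolution vanishes
(`FourierVanishes.tensor`).

The dictionary is proved by induction. A functional on `δ̄_a(τ_x F)(b)` is a functional on `F (x ⊕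
(a ⊕ b))` that is invariant under shears and zero on `F (x ⊕ b)`; `FourierVanishes.succ` and
`FourierVanishes.deltaBar_tau` show that `δ̄_a τ_x` lowers the depth threshold by exactly one. -/

namespace ParabolicFunctors

/-! ### Characters of finite abelian groups and Fourier inversion. -/

section Duality

variable {A K : Type*} [AddCommGroup A] [Field K]

instance finite_addChar [Finite A] : Finite (AddChar A K) := by
  have h := (linearIndependent_monoidHom (Multiplicative A) K).finite
  exact Finite.of_equiv _ AddChar.toMonoidHomEquiv.symm

noncomputable instance fintypeAddChar [Finite A] : Fintype (AddChar A K) := Fintype.ofFinite _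

variable [IsAlgClosed K]

lemma hasEnoughRootsOfUnity_of_card_ne_zero (hA : (Nat.card A : K) ≠ 0) :
    HasEnoughRootsOfUnity K (Monoid.exponent (Multiplicative A)) := by
  have : NeZero ((Monoid.exponent (Multiplicative A) : ℕ) : K) := by
    refine ⟨fun h => hA ?_⟩
    obtain ⟨m, hm⟩ : Monoid.exponent (Multiplicative A) ∣ Nat.card A :=
      Group.exponent_dvd_nat_card (G := Multiplicative A)
    rw [hm, Nat.cast_mul, h, zero_mul]
  infer_instance

/-- Characters of a finite group of order invertible in `K` separate points. -/
lemma exists_addChar_ne_one [Finite A] (hA : (Nat.card A : K) ≠ 0) {a : A} (ha : a ≠ 0) : ∃ χ : AddChar A K, χ a ≠ 1 := by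
  have := hasEnoughRootsOfUnity_of_card_ne_zero hA
  obtain ⟨φ, hφ⟩ := CommGroup.exists_apply_ne_one_of_hasEnoughRootsOfUnity (Multiplicative A) K
    (a := Multiplicative.ofAdd a) (by simpa using ha)
  refine ⟨AddChar.toMonoidHomEquiv.symm ((Units.coeHom K).comp φ), fun h => hφ ?_⟩
  exact Units.ext h

lemma card_addChar [Finite A] (hA : (Nat.card A : K) ≠ 0) : Nat.card (AddChar A K) = Nat.card A := by
  have := hasEnoughRootsOfUnity_of_card_ne_zero hA
  have h := CommGroup.card_monoidHom_of_hasEnoughRootsOfUnity (Multiplicative A) K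
  rw [show Nat.card A = Nat.card (Multiplicative A) from rfl, ← h]
  refine Nat.card_congr (AddChar.toMonoidHomEquiv.trans ⟨MonoidHom.toHomUnits,
    fun φ => (Units.coeHom K).comp φ, fun φ => ?_, fun φ => ?_⟩)
  · ext; rfl
  · ext; rfl

lemma sum_addChar_apply_eq_zero [Finite A] (hA : (Nat.card A : K) ≠ 0) {a : A} (ha : a ≠ 0) : ∑ χ : AddChar A K, χ a = 0 := by
  obtain ⟨ψ, hψ⟩ := exists_addChar_ne_one hA ha
  have h : ψ a * ∑ χ : AddChar A K, χ a = ∑ χ : AddChar A K, χ a := by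
    rw [Finset.mul_sum]
    exact Fintype.sum_equiv (Equiv.mulLeft ψ) _ _ fun χ => rfl
  have h' : (ψ a - 1) * ∑ χ : AddChar A K, χ a = 0 := by rw [sub_mul, h, one_mul, sub_self]
  exact (mul_eq_zero.1 h').resolve_left (sub_ne_zero.2 hψ)

lemma sum_addChar_zero [Finite A] (hA : (Nat.card A : K) ≠ 0) : ∑ χ : AddChar A K, χ 0 = Nat.card A := by
  simp [← card_addChar hA, Nat.card_eq_fintype_card]

/-- Dual orthogonality, integrated against a function. -/
lemma sum_addChar_sum_mul [Fintype A] (hA : (Nat.card A : K) ≠ 0) (a : A) (f : A → K) :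
    ∑ χ : AddChar A K, ∑ v, χ (v - a) * f v = Nat.card A * f a := by
  rw [Finset.sum_comm, Finset.sum_eq_single a]
  · rw [← Finset.sum_mul, sub_self, sum_addChar_zero hA]
  · intro v _ hv
    rw [← Finset.sum_mul, sum_addChar_apply_eq_zero hA (sub_ne_zero.2 hv), zero_mul]
  · simp

/-- A function on a finite group whose Fourier coefficients vanish is zero. -/
lemma eq_zero_of_forall_sum_addChar_mul_eq_zero [Fintype A] (hA : (Nat.card A : K) ≠ 0)
    (f : A → K) (hf : ∀ χ : AddChar A K, ∑ v, χ v * f v = 0) (a : A) : f a = 0 := by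
  refine (mul_eq_zero.1 ?_).resolve_left hA
  rw [← sum_addChar_sum_mul hA]
  refine Finset.sum_eq_zero fun χ _ => ?_
  have h := congrArg (χ (-a) * ·) (hf χ)
  simp only [Finset.mul_sum, mul_zero] at h
  rw [← h]
  refine Finset.sum_congr rfl fun v _ => ?_
  rw [sub_eq_neg_add, AddChar.map_add_eq_mul, mul_assoc]

end Duality

/-! ### Depth of characters and its subadditivity. -/

section Depth

variable {C : Type u} [Category.{v} C] [Preadditive C] {K : Type*} [Field K]

/-- The restriction of a character of `Hom(y, P)` along a morphism `b ⟶ P`. -/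
def pull {y b P : C} (χ : AddChar (y ⟶ P) K) (i : b ⟶ P) : AddChar (y ⟶ b) K :=
  χ.compAddMonoidHom (Preadditive.rightComp y i)

@[simp]
lemma pull_apply {y b P : C} (χ : AddChar (y ⟶ P) K) (i : b ⟶ P) (v : y ⟶ b) :
    pull χ i v = χ (v ≫ i) := rfl

lemma pull_comp {y a b P : C} (χ : AddChar (y ⟶ P) K) (i : b ⟶ P) (u : a ⟶ b) :
    pull χ (u ≫ i) = pull (pull χ i) u := by
  ext v; simp

lemma pull_add {y b P : C} (χ : AddChar (y ⟶ P) K) (i j : b ⟶ P) :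
    pull χ (i + j) = pull χ i * pull χ j := by
  ext v; simp [AddChar.map_add_eq_mul]

lemma mul_pull {y b P : C} (χ χ' : AddChar (y ⟶ P) K) (i : b ⟶ P) :
    pull (χ * χ') i = pull χ i * pull χ' i := by
  ext v; simp

/-- `Deep r χ` holds if the subfunctor of `a ↦ (Hom(y, a))^∨` generated by the character `χ` of
`Hom(y, P)` contains a strictly increasing chain with `r` steps. -/
inductive Deep {y : C} : ℕ → ∀ {P : C}, AddChar (y ⟶ P) K → Prop
  | zero {P : C} (χ : AddChar (y ⟶ P) K) : Deep 0 χ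
  | succ {r : ℕ} {a b P : C} (χ : AddChar (y ⟶ P) K) (i : b ⟶ P) (j : a ⟶ P)
      (hi : Deep r (pull χ i)) (hj : ∀ u : a ⟶ b, pull χ j ≠ pull χ (u ≫ i)) : Deep (r + 1) χ

lemma Deep.of_pull {y b P : C} {χ : AddChar (y ⟶ P) K} (i : b ⟶ P) {r : ℕ}
    (h : Deep r (pull χ i)) : Deep r χ := by
  generalize hψ : pull χ i = ψ at h
  cases h with
  | zero => exact .zero _
  | succ _ i' j' hi hj =>
    subst hψ
    refine .succ χ (i' ≫ i) (j' ≫ i) (by rwa [pull_comp]) fun u => ?_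
    rw [← Category.assoc, pull_comp, pull_comp]
    exact hj u

lemma Deep.of_succ {y P : C} {χ : AddChar (y ⟶ P) K} {r : ℕ} (h : Deep (r + 1) χ) :
    Deep r χ := by
  cases h with
  | succ _ i _ hi _ => exact hi.of_pull i

lemma Deep.mono {y P : C} {χ : AddChar (y ⟶ P) K} {r s : ℕ} (hrs : r ≤ s) (h : Deep s χ) :
    Deep r χ := by
  induction hrs with
  | refl => exact h
  | step _ ih => exact ih h.of_succ

/-- Restrictions of `χ` that differ come from restrictions of `ψ` that differ, so the same chain
serves for `ψ`. -/
lemma Deep.of_comp_left {y Y P : C} (p : Y ⟶ y) {r : ℕ} {χ : AddChar (y ⟶ P) K} (h : Deep r χ)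
    (ψ : AddChar (Y ⟶ P) K) (hψ : ∀ v, χ v = ψ (p ≫ v)) : Deep r ψ := by
  induction h with
  | zero => exact .zero _
  | succ χ i j _ hj ih =>
    refine .succ ψ i j (ih _ fun v => by simp [hψ]) fun u h => hj u ?_
    ext v
    simpa [hψ] using DFunLike.congr_fun h (p ≫ v)

/-- Each step of the chain for the product is charged to `χ` if it is strict for `χ`, and otherwise
to `χ'`. The morphism `e`, which kills `χ`, strengthens the induction: corrections along `e` change
`χ'` without changing `χ`. -/
lemma Deep.of_mul [HasBinaryBiproducts C] {y P : C} {r : ℕ} {ψ : AddChar (y ⟶ P) K}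
    (h : Deep r ψ) (χ χ' : AddChar (y ⟶ P) K) (hψ : ψ = χ * χ') :
    ∃ p q, p + q = r ∧ Deep p χ ∧
      ∃ (c : C) (e : c ⟶ P), pull χ e = 1 ∧ Deep q (pull χ' e) := by
  induction h with
  | @zero P _ =>
    refine ⟨0, 0, rfl, .zero _, P, 0, ?_, .zero _⟩
    ext v; simp
  | @succ r a b P ψ i j hi hj ih =>
    obtain ⟨p, q, hpq, hp, c, e, he, hq⟩ := ih (pull χ i) (pull χ' i) (by rw [hψ, mul_pull])
    by_cases hu : ∃ u : a ⟶ b, pull χ j = pull χ (u ≫ i)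
    · obtain ⟨u, hu⟩ := hu
      -- The step is not strict for `χ`: correcting `j` by `u ≫ i` kills `χ`, so the corrected map
      -- can be adjoined to `e`.
      have hu' : pull χ (j - u ≫ i) = 1 := by
        ext v
        have := DFunLike.congr_fun hu v
        simp only [pull_apply] at this
        simp [AddChar.map_sub_eq_div, this, div_self (χ.val_isUnit _).ne_zero]
      refine ⟨p, q + 1, by omega, hp.of_pull i, c ⊞ a, biprod.desc (e ≫ i) (j - u ≫ i), ?_,
        .succ _ biprod.inl biprod.inr ?_ fun w hw => ?_⟩
      · ext v
        have h1 := DFunLike.congr_fun he (v ≫ biprod.fst)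
        have h2 := DFunLike.congr_fun hu' (v ≫ biprod.snd)
        simp only [pull_apply, Category.assoc, AddChar.one_apply] at h1 h2
        simp only [pull_apply, biprod.desc_eq, Preadditive.comp_add, AddChar.map_add_eq_mul, h1, h2,
          AddChar.one_apply, mul_one]
      · rwa [← pull_comp, biprod.inl_desc, pull_comp]
      -- If the step were not strict for `χ'` either, `j` and `(u + w ≫ e) ≫ i` would give equal
      -- restrictions of both factors, hence of `ψ`.
      · apply hj (u + w ≫ e)
        have h1 : pull χ' j = pull χ' ((u + w ≫ e) ≫ i) := by
          rw [← pull_comp, ← pull_comp, biprod.inr_desc, Category.assoc, biprod.inl_desc] at hw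
          rw [Preadditive.add_comp, pull_add, Category.assoc, ← hw, ← pull_add]
          simp
        have h2 : pull χ j = pull χ ((u + w ≫ e) ≫ i) := by
          rw [Preadditive.add_comp, pull_add, ← hu, Category.assoc, ← Category.assoc,
            Category.assoc, pull_comp χ (e ≫ i), pull_comp, he]
          ext v; simp
        rw [hψ, mul_pull, mul_pull, h1, h2]
    · exact ⟨p + 1, q, by omega, .succ χ i j hp fun u h => hu ⟨u, h⟩, c, e ≫ i,
        by rw [pull_comp, he], by rwa [pull_comp]⟩

end Depth

/-! ### Vanishing of Fourier coefficients and tensor products. -/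

section Vanishing

variable {k : Type w} [Field k] {C : Type u} [Category.{v} C] [Preadditive C]
  [∀ x y : C, Fintype (x ⟶ y)]

/-- All Fourier coefficients of matrix coefficients `v ↦ ℓ (F v z)` on groups `Hom(y, P)` vanish
at the characters of depth at least `r`. -/
def FourierVanishes (K : Type*) [Field K] [Algebra k K] (r : ℕ) (F : C ⥤ ModuleCat.{w} k) : Prop :=
  ∀ ⦃y P : C⦄ (χ : AddChar (y ⟶ P) K), Deep r χ → ∀ (ℓ : F.obj P →ₗ[k] K) (z : F.obj y),
    ∑ v, χ v * ℓ ((F.map v).hom z) = 0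

variable {K : Type*} [Field K] [Algebra k K]

lemma FourierVanishes.tensor [IsAlgClosed K] [HasBinaryBiproducts C]
    (hK : ∀ x y : C, (Nat.card (x ⟶ y) : K) ≠ 0) {n m : ℕ}
    {F G : C ⥤ ModuleCat.{w} k} (hF : FourierVanishes K (n + 1) F)
    (hG : FourierVanishes K (m + 1) G) : FourierVanishes K (n + m + 1) (F ⊗ G) := by
  intro y P χ hχ ℓ z
  let ℓ' : TensorProduct k (F.obj P) (G.obj P) →ₗ[k] K := ℓ
  suffices h : ∀ z : TensorProduct k (F.obj y) (G.obj y),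
      ∑ v : y ⟶ P, χ v * ℓ' (TensorProduct.map (F.map v).hom (G.map v).hom z) = 0 from h z
  intro z
  induction z using TensorProduct.induction_on with
  | zero => simp
  | add a b ha hb => simp only [map_add, mul_add, Finset.sum_add_distrib, ha, hb, add_zero]
  | tmul z t =>
    let B (v v' : y ⟶ P) : K := ℓ' ((F.map v).hom z ⊗ₜ (G.map v').hom t)
    change ∑ v, χ v * B v v = 0
    -- Fourier inversion in the second variable separates the diagonal sum into a convolution over
    -- factorizations `χ = (χ * ψ⁻¹) * ψ`.
    refine (mul_eq_zero.1 ?_).resolve_left (hK y P)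
    calc (Nat.card (y ⟶ P) : K) * ∑ v, χ v * B v v
        = ∑ v, χ v * ∑ ψ : AddChar (y ⟶ P) K, ∑ v', ψ (v' - v) * B v v' := by
          rw [Finset.mul_sum]
          refine Finset.sum_congr rfl fun v _ => ?_
          rw [sum_addChar_sum_mul (hK y P)]
          ring
      _ = ∑ ψ : AddChar (y ⟶ P) K, ∑ v, ∑ v', (χ * ψ⁻¹) v * (ψ v' * B v v') := by
          simp only [Finset.mul_sum]
          rw [Finset.sum_comm]
          refine Finset.sum_congr rfl fun ψ _ => Finset.sum_congr rfl fun v _ =>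
            Finset.sum_congr rfl fun v' _ => ?_
          rw [sub_eq_add_neg, AddChar.map_add_eq_mul, AddChar.mul_apply, AddChar.inv_apply]
          ring
      _ = 0 := by
          refine Finset.sum_eq_zero fun ψ _ => ?_
          obtain ⟨p, q, hpq, hp, c, e, -, hq⟩ := hχ.of_mul (χ * ψ⁻¹) ψ (by simp)
          -- Since `p + q = n + m + 1`, failure of this inequality gives `m + 1 ≤ q`.
          by_cases h : n + 1 ≤ p
          · rw [Finset.sum_comm]
            refine Finset.sum_eq_zero fun v' _ => ?_
            have := hF (χ * ψ⁻¹) (hp.mono h)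
              (ℓ' ∘ₗ (TensorProduct.mk k (F.obj P) (G.obj P)).flip ((G.map v').hom t)) z
            have h2 := congrArg (ψ v' * ·) this
            simp only [Finset.mul_sum, mul_zero] at h2
            rw [← h2]
            exact Finset.sum_congr rfl fun v _ => mul_left_comm _ _ _
          · refine Finset.sum_eq_zero fun v _ => ?_
            rw [← Finset.mul_sum]
            have := hG ψ ((hq.of_pull e).mono (by omega))
              (ℓ' ∘ₗ TensorProduct.mk k (F.obj P) (G.obj P) ((F.map v).hom z)) t
            exact mul_eq_zero_of_right _ this

lemma fourierVanishes_of_isZero (r : ℕ) {F : C ⥤ ModuleCat.{w} k} (hF : IsZero F) :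
    FourierVanishes K r F := by
  intro y P χ _ ℓ z
  have : Subsingleton (F.obj P) := ModuleCat.subsingleton_of_isZero (hF.obj P)
  refine Finset.sum_eq_zero fun v _ => ?_
  rw [Subsingleton.elim ((F.map v).hom z) 0, map_zero, mul_zero]

/-- Every character has depth at least `0`, so all matrix coefficients vanish; their value at the
identity of `P` is `ℓ z`. -/
lemma FourierVanishes.isZero [IsAlgClosed K] (hK : ∀ x y : C, (Nat.card (x ⟶ y) : K) ≠ 0)
    {F : C ⥤ ModuleCat.{w} k} (hF : FourierVanishes K 0 F) : IsZero F := by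
  refine Functor.isZero _ fun P => ?_
  rw [ModuleCat.isZero_iff_subsingleton]
  refine subsingleton_of_forall_eq 0 fun z => ?_
  rw [← Module.forall_dual_apply_eq_zero_iff k]
  intro ℓ
  have h := eq_zero_of_forall_sum_addChar_mul_eq_zero (hK P P) _
    (fun χ => hF χ (.zero χ) (Algebra.linearMap k K ∘ₗ ℓ) z) (𝟙 P)
  simpa using h

end Vanishing

lemma hom_map_hom_map {k : Type w} [Field k] {C : Type u} [Category.{v} C]
    (F : C ⥤ ModuleCat.{w} k) {x y z : C} (f : x ⟶ y) (g : y ⟶ z)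
    (m : F.obj x) : (F.map g).hom ((F.map f).hom m) = (F.map (f ≫ g)).hom m := by
  rw [F.map_comp]; rfl

/-! ### Elements and functionals of `δ̄_a(F)` and `δ̄_a(τ_x(F))`. -/

section DeltaBar

variable {k : Type w} [Field k] {C : Type u} [Category.{v} C] [Preadditive C]
  [HasBinaryBiproducts C]

/-- The canonical projection `F (a ⊕ b) → δ̄_a(F)(b)`. -/
noncomputable def deltaBarProj (a : C) (F : C ⥤ ModuleCat.{w} k) (b : C) :
    F.obj (a ⊞ b) →ₗ[k] ((deltaBar k a).obj F).obj b :=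
  (((tauToTauBar k a).app F ≫ cokernel.π ((idToTauBar k a).app F)).app b).hom

lemma deltaBarProj_surjective (a : C) (F : C ⥤ ModuleCat.{w} k) (b : C) :
    Function.Surjective (deltaBarProj a F b) := by
  have h : Function.Surjective ((cokernel.π ((idToTauBar k a).app F)).app b).hom := by
    rw [← ModuleCat.epi_iff_surjective]
    infer_instance
  exact h.comp (Representation.Coinvariants.mk_surjective (shearRep F a b))

lemma deltaBarProj_naturality (a : C) (F : C ⥤ ModuleCat.{w} k) {b b' : C} (f : b ⟶ b')
    (z : F.obj (a ⊞ b)) :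
    (((deltaBar k a).obj F).map f).hom (deltaBarProj a F b z) =
      deltaBarProj a F b' ((F.map (biprod.map (𝟙 a) f)).hom z) := by
  have h := ((tauToTauBar k a).app F ≫ cokernel.π ((idToTauBar k a).app F)).naturality f
  exact (congrArg (fun g => g.hom z) h).symm

lemma deltaBarProj_shear (a : C) (F : C ⥤ ModuleCat.{w} k) {b : C} (u : a ⟶ b)
    (z : F.obj (a ⊞ b)) :
    deltaBarProj a F b ((F.map (Biprod.unipotentUpper u).hom).hom z) = deltaBarProj a F b z :=
  congrArg ((cokernel.π ((idToTauBar k a).app F)).app b).hom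
    (Representation.Coinvariants.mk_self_apply (shearRep F a b) (Multiplicative.ofAdd u) z)

lemma deltaBarProj_inr (a : C) (F : C ⥤ ModuleCat.{w} k) {b : C} (z : F.obj b) :
    deltaBarProj a F b ((F.map biprod.inr).hom z) = 0 := by
  have h : ((idToTauBar k a).app F ≫ cokernel.π ((idToTauBar k a).app F)).app b = 0 := by
    rw [cokernel.condition]; rfl
  exact congrArg (fun g => g.hom z) h

/-- A linear map on `F (a ⊕ b)` that is invariant under the shears and vanishes on the image of
`F b` factors through `δ̄_a(F)(b)`. -/
lemma exists_deltaBarProj_comp (a : C) (F : C ⥤ ModuleCat.{w} k) (b : C)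
    {V : Type w} [AddCommGroup V] [Module k V] (ℓ : F.obj (a ⊞ b) →ₗ[k] V)
    (hs : ∀ (u : a ⟶ b) z, ℓ ((F.map (Biprod.unipotentUpper u).hom).hom z) = ℓ z)
    (hi : ∀ z, ℓ ((F.map biprod.inr).hom z) = 0) :
    ∃ μ : ((deltaBar k a).obj F).obj b →ₗ[k] V, ∀ z, μ (deltaBarProj a F b z) = ℓ z := by
  let ℓ' : (shearRep F a b).Coinvariants →ₗ[k] V := Representation.Coinvariants.lift _ ℓ
    fun u => LinearMap.ext fun z => hs u.toAdd z
  let c := CokernelCofork.mapIsColimit _ (cokernelIsCokernel ((idToTauBar k a).app F))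
    ((evaluation C (ModuleCat.{w} k)).obj b)
  let g : ((tauBar k a).obj F).obj b ⟶ ModuleCat.of k V := ModuleCat.ofHom ℓ'
  obtain ⟨d, hd⟩ := CokernelCofork.IsColimit.desc' c g (by
    apply ModuleCat.hom_ext
    ext z
    exact hi z)
  refine ⟨d.hom, fun z => ?_⟩
  exact congrArg (fun g => g.hom (Representation.Coinvariants.mk (shearRep F a b) z)) hd

/-- The canonical projection `F (x ⊕ (a ⊕ b)) → δ̄_a(τ_x(F))(b)`. -/
noncomputable def deltaTauProj (a x : C) (F : C ⥤ ModuleCat.{w} k) (b : C) :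
    F.obj (x ⊞ (a ⊞ b)) →ₗ[k] ((deltaBar k a).obj ((tau k x).obj F)).obj b :=
  deltaBarProj a ((tau k x).obj F) b

lemma deltaTauProj_surjective (a x : C) (F : C ⥤ ModuleCat.{w} k) (b : C) :
    Function.Surjective (deltaTauProj a x F b) :=
  deltaBarProj_surjective a ((tau k x).obj F) b

lemma deltaTauProj_naturality (a x : C) (F : C ⥤ ModuleCat.{w} k) {b b' : C} (f : b ⟶ b')
    (z : F.obj (x ⊞ (a ⊞ b))) :
    (((deltaBar k a).obj ((tau k x).obj F)).map f).hom (deltaTauProj a x F b z) =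
      deltaTauProj a x F b' ((F.map (biprod.map (𝟙 x) (biprod.map (𝟙 a) f))).hom z) :=
  deltaBarProj_naturality a ((tau k x).obj F) f z

lemma deltaTauProj_shear (a x : C) (F : C ⥤ ModuleCat.{w} k) {b : C} (u : a ⟶ b)
    (z : F.obj (x ⊞ (a ⊞ b))) :
    deltaTauProj a x F b
      ((F.map (biprod.map (𝟙 x) (Biprod.unipotentUpper u).hom)).hom z) = deltaTauProj a x F b z :=
  deltaBarProj_shear a ((tau k x).obj F) u z

lemma deltaTauProj_inr (a x : C) (F : C ⥤ ModuleCat.{w} k) {b : C} (z : F.obj (x ⊞ b)) :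
    deltaTauProj a x F b ((F.map (biprod.map (𝟙 x) biprod.inr)).hom z) = 0 :=
  deltaBarProj_inr a ((tau k x).obj F) z

lemma exists_deltaTauProj_comp (a x : C) (F : C ⥤ ModuleCat.{w} k) (b : C)
    {V : Type w} [AddCommGroup V] [Module k V] (ℓ : F.obj (x ⊞ (a ⊞ b)) →ₗ[k] V)
    (hs : ∀ (u : a ⟶ b) z,
      ℓ ((F.map (biprod.map (𝟙 x) (Biprod.unipotentUpper u).hom)).hom z) = ℓ z)
    (hi : ∀ z, ℓ ((F.map (biprod.map (𝟙 x) biprod.inr)).hom z) = 0) :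
    ∃ μ : ((deltaBar k a).obj ((tau k x).obj F)).obj b →ₗ[k] V,
      ∀ z, μ (deltaTauProj a x F b z) = ℓ z :=
  exists_deltaBarProj_comp a ((tau k x).obj F) b ℓ hs hi

end DeltaBar

/-! ### From vanishing for all `δ̄_a τ_x F` to vanishing for `F`. -/

section Recursion

variable {k : Type w} [Field k] {C : Type u} [Category.{v} C] [Preadditive C]
  [∀ x y : C, Fintype (x ⟶ y)] {K : Type w} [Field K]

lemma card_addSubgroup_ne_zero {A : Type*} [AddGroup A] (hA : (Nat.card A : K) ≠ 0)
    (H : AddSubgroup A) : (Nat.card H : K) ≠ 0 := by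
  obtain ⟨m, hm⟩ := H.card_addSubgroup_dvd_card
  rw [hm, Nat.cast_mul] at hA
  exact left_ne_zero_of_mul hA

lemma sum_addChar_mul_add {A : Type*} [AddCommGroup A] [Fintype A] (χ : AddChar A K) (f : A → K)
    (c : A) : ∑ v, χ v * f (v + c) = χ (-c) * ∑ v, χ v * f v := by
  rw [Finset.mul_sum]
  refine Fintype.sum_equiv (Equiv.addRight c) _ _ fun v => ?_
  rw [Equiv.coe_addRight, ← mul_assoc, ← AddChar.map_add_eq_mul, neg_add_cancel_comm_assoc]

/-- The sum over `Hom(y, a) × Hom(a, b)` that detects a strict step of a chain of characters. -/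
lemma sum_pull_sub_ne_zero (hK : ∀ x y : C, (Nat.card (x ⟶ y) : K) ≠ 0) {y a b P : C}
    (χ : AddChar (y ⟶ P) K) (i : b ⟶ P) (j : a ⟶ P)
    (hj : ∀ u : a ⟶ b, pull χ j ≠ pull χ (u ≫ i)) :
    ∑ t : y ⟶ a, ∑ u : a ⟶ b, (χ (-(t ≫ u ≫ i)) - χ (t ≫ j - t ≫ u ≫ i)) ≠ 0 := by
  classical
  let H : AddSubgroup (a ⟶ b) :=
    { carrier := {u | pull χ (u ≫ i) = 1}
      zero_mem' := by
        simp only [Set.mem_ofPred_eq, zero_comp]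
        ext v; simp
      add_mem' := fun {u u'} hu hu' => by
        simp only [Set.mem_ofPred_eq, Preadditive.add_comp, pull_add] at hu hu' ⊢
        rw [hu, hu', one_mul]
      neg_mem' := fun {u} hu => by
        ext v
        have := DFunLike.congr_fun hu v
        simp only [pull_apply, AddChar.one_apply] at this
        simp [AddChar.map_neg_eq_inv, this] }
  -- By orthogonality the first terms contribute `|H| * |Hom(y, a)|` in total, which is invertible,
  -- while strictness makes every second sum zero.
  have h1 (u : a ⟶ b) : ∑ t : y ⟶ a, χ (-(t ≫ u ≫ i)) =
      if u ∈ H then (Nat.card (y ⟶ a) : K) else 0 := by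
    have := AddChar.sum_eq_ite (pull χ (u ≫ i))⁻¹
    simp only [AddChar.inv_apply, pull_apply, Preadditive.neg_comp] at this
    rw [this, ← AddChar.one_eq_zero, Nat.card_eq_fintype_card]
    simp only [inv_eq_one]
    rfl
  have h2 (u : a ⟶ b) : ∑ t : y ⟶ a, χ (t ≫ j - t ≫ u ≫ i) = 0 := by
    have := AddChar.sum_eq_ite (pull χ (j - u ≫ i))
    rw [if_neg] at this
    · simpa using this
    · intro h
      apply hj u
      ext v
      have h' := DFunLike.congr_fun h v
      simpa [AddChar.map_sub_eq_div, div_eq_one_iff_eq (χ.val_isUnit _).ne_zero] using h'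
  rw [Finset.sum_comm]
  simp only [Finset.sum_sub_distrib, h1, h2, sub_zero]
  rw [← Finset.sum_filter, Finset.sum_const, nsmul_eq_mul]
  refine mul_ne_zero ?_ (hK _ _)
  convert card_addSubgroup_ne_zero (hK a b) H
  rw [Nat.card_eq_fintype_card, Fintype.card_subtype]

variable [Algebra k K] [HasBinaryBiproducts C]

/-- A strict step `(i, j)` of the chain yields functionals on `δ̄_a(τ_y F)(b)`. Vanishing at the
shallower character `pull χ i` gives relations between translates of the matrix coefficient; under
the Fourier transform at `χ` they become a nonzero scalar times the wanted coefficient. -/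
lemma FourierVanishes.succ (hK : ∀ x y : C, (Nat.card (x ⟶ y) : K) ≠ 0) {r : ℕ}
    {F : C ⥤ ModuleCat.{w} k}
    (hF : ∀ a x, FourierVanishes K r ((deltaBar k a).obj ((tau k x).obj F))) :
    FourierVanishes K (r + 1) F := by
  intro y P χ hχ ℓ z
  cases hχ with
  | @succ _ a b _ _ i j hi hj =>
  set f : (y ⟶ P) → K := fun v => ℓ ((F.map v).hom z) with hf
  have key (v : y ⟶ P) (t : y ⟶ a) : ∑ s : y ⟶ b, χ (s ≫ i) *
      ∑ u : a ⟶ b, (f (v + (t ≫ j + t ≫ u ≫ i + s ≫ i)) - f (v + (t ≫ u ≫ i + s ≫ i))) = 0 := by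
    let Φ (g : a ⟶ P) : y ⊞ (a ⊞ b) ⟶ P := biprod.desc v (biprod.desc g i)
    -- A shear permutes the summands over `u`, and the two terms of each difference agree on `F (y ⊕
    -- b)`, so this functional descends to `δ̄_a(τ_y F)(b)`.
    let lam : F.obj (y ⊞ (a ⊞ b)) →ₗ[k] K :=
      ∑ u : a ⟶ b, (ℓ ∘ₗ (F.map (Φ (j + u ≫ i))).hom - ℓ ∘ₗ (F.map (Φ (u ≫ i))).hom)
    have hlam (m) : lam m = ∑ u : a ⟶ b,
        (ℓ ((F.map (Φ (j + u ≫ i))).hom m) - ℓ ((F.map (Φ (u ≫ i))).hom m)) := by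
      simp [lam]
    obtain ⟨μ, hμ⟩ := exists_deltaTauProj_comp a y F b lam (fun u m => by
      rw [hlam, hlam]
      refine Fintype.sum_equiv (Equiv.addRight u) _ _ fun u' => ?_
      have h (g : a ⟶ P) : biprod.map (𝟙 y) (Biprod.unipotentUpper u).hom ≫ Φ g =
          Φ (g + u ≫ i) := by
        simp only [Φ]
        ext <;> simp [Biprod.ofComponents]
      rw [hom_map_hom_map, hom_map_hom_map, h, h]
      simp [add_assoc]) (fun m => by
      rw [hlam]
      refine Finset.sum_eq_zero fun u _ => ?_
      have h (g : a ⟶ P) : biprod.map (𝟙 y) biprod.inr ≫ Φ g = biprod.desc v i := by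
        simp only [Φ]
        ext <;> simp
      rw [hom_map_hom_map, hom_map_hom_map, h, h, sub_self])
    have h := hF a y (pull χ i) hi μ (deltaTauProj a y F y
      ((F.map (biprod.lift (𝟙 y) (biprod.lift t (𝟙 y)))).hom z))
    rw [← h]
    refine Finset.sum_congr rfl fun s _ => ?_
    rw [deltaTauProj_naturality, hμ, hlam, pull_apply]
    congr 1
    refine Finset.sum_congr rfl fun u _ => ?_
    have h (g : a ⟶ P) : biprod.lift (𝟙 y) (biprod.lift t (𝟙 y)) ≫
        biprod.map (𝟙 y) (biprod.map (𝟙 a) s) ≫ Φ g = v + (t ≫ g + s ≫ i) := by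
      simp only [Φ]
      rw [biprod.map_eq, biprod.map_eq]
      simp
    simp only [hom_map_hom_map, Category.assoc, h, Preadditive.comp_add, hf]
  set S := ∑ v, χ v * f v with hS
  -- Summing `key` against `χ v` turns translations into scalars; `χ (s ≫ i)` cancels the shift by
  -- `s ≫ i`, so each `s` contributes equally.
  have key2 (t : y ⟶ a) : (Nat.card (y ⟶ b) : K) * S *
      ∑ u : a ⟶ b, (χ (-(t ≫ j + t ≫ u ≫ i)) - χ (-(t ≫ u ≫ i))) = 0 := by
    have h : ∑ v, χ v * ∑ s : y ⟶ b, χ (s ≫ i) * ∑ u : a ⟶ b,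
        (f (v + (t ≫ j + t ≫ u ≫ i + s ≫ i)) - f (v + (t ≫ u ≫ i + s ≫ i))) = 0 :=
      Finset.sum_eq_zero fun v _ => by rw [key, mul_zero]
    rw [← h, Finset.mul_sum]
    calc ∑ u : a ⟶ b, (Nat.card (y ⟶ b) : K) * S *
          (χ (-(t ≫ j + t ≫ u ≫ i)) - χ (-(t ≫ u ≫ i)))
        = ∑ u : a ⟶ b, ∑ s : y ⟶ b, χ (s ≫ i) *
            (∑ v, χ v * f (v + (t ≫ j + t ≫ u ≫ i + s ≫ i)) -
              ∑ v, χ v * f (v + (t ≫ u ≫ i + s ≫ i))) := by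
          refine Finset.sum_congr rfl fun u _ => ?_
          have hs (s : y ⟶ b) (c : y ⟶ P) : χ (s ≫ i) * χ (-(c + s ≫ i)) = χ (-c) := by
            rw [← AddChar.map_add_eq_mul]
            congr 1
            abel
          simp only [sum_addChar_mul_add, mul_sub, ← mul_assoc, hs]
          rw [Finset.sum_const, Finset.card_univ, ← Nat.card_eq_fintype_card, nsmul_eq_mul]
          ring
      _ = _ := by
          simp only [Finset.mul_sum, ← Finset.sum_sub_distrib]
          rw [Finset.sum_comm]
          conv_rhs => rw [Finset.sum_comm]
          refine Finset.sum_congr rfl fun s _ => ?_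
          rw [Finset.sum_comm]
          exact Finset.sum_congr rfl fun v _ => Finset.sum_congr rfl fun u _ => by ring
  -- Weighting `key2` by `χ (t ≫ j)` before summing over `t` produces the factor of
  -- `sum_pull_sub_ne_zero`.
  have key3 : (Nat.card (y ⟶ b) : K) * S *
      ∑ t : y ⟶ a, ∑ u : a ⟶ b, (χ (-(t ≫ u ≫ i)) - χ (t ≫ j - t ≫ u ≫ i)) = 0 := by
    rw [Finset.mul_sum]
    refine Finset.sum_eq_zero fun t _ => ?_
    have h := congrArg (χ (t ≫ j) * ·) (key2 t)
    simp only [mul_zero] at h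
    rw [← h, mul_left_comm]
    congr 1
    rw [Finset.mul_sum]
    refine Finset.sum_congr rfl fun u _ => ?_
    rw [mul_sub, ← AddChar.map_add_eq_mul, ← AddChar.map_add_eq_mul, ← sub_eq_add_neg,
      ← sub_eq_add_neg, sub_add_cancel_left]
  exact (mul_eq_zero.1 ((mul_eq_zero.1 key3).resolve_right (sum_pull_sub_ne_zero hK χ i j hj))
    ).resolve_left (hK _ _)

end Recursion

/-! ### Fourier coefficients of restrictions to cosets. -/

section Restriction

variable {C : Type u} [Category.{v} C] [Preadditive C] [∀ x y : C, Fintype (x ⟶ y)]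
  {K : Type w} [Field K] [IsAlgClosed K]

/-- Fourier coefficients of the restriction of a function on `Hom(Y, Q)` to a coset of the image
of `Hom(y, P)`. -/
lemma sum_mul_restrict_eq_zero (hK : ∀ x y : C, (Nat.card (x ⟶ y) : K) ≠ 0) {r : ℕ} {y Y P Q : C}
    (q : Y ⟶ y) (g : P ⟶ Q) (c : Y ⟶ Q) (f : (Y ⟶ Q) → K)
    (hf : ∀ ψ : AddChar (Y ⟶ Q) K, Deep r (pull ψ g) → ∑ w, ψ w * f w = 0)
    (χ : AddChar (y ⟶ P) K) (hχ : Deep r χ) : ∑ v, χ v * f (q ≫ v ≫ g + c) = 0 := by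
  refine (mul_eq_zero.1 ?_).resolve_left (hK Y Q)
  calc (Nat.card (Y ⟶ Q) : K) * ∑ v, χ v * f (q ≫ v ≫ g + c)
      = ∑ v, χ v * ∑ ψ : AddChar (Y ⟶ Q) K, ∑ w, ψ (w - (q ≫ v ≫ g + c)) * f w := by
        rw [Finset.mul_sum]
        refine Finset.sum_congr rfl fun v _ => ?_
        rw [sum_addChar_sum_mul (hK Y Q), mul_left_comm]
    _ = ∑ ψ : AddChar (Y ⟶ Q) K, (∑ v, χ v * ψ (-(q ≫ v ≫ g))) * (ψ (-c) * ∑ w, ψ w * f w) := by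
        simp only [Finset.mul_sum, Finset.sum_mul]
        rw [Finset.sum_comm]
        refine Finset.sum_congr rfl fun ψ _ => ?_
        rw [Finset.sum_comm]
        refine Finset.sum_congr rfl fun w _ => Finset.sum_congr rfl fun v _ => ?_
        rw [sub_eq_add_neg, neg_add, AddChar.map_add_eq_mul, AddChar.map_add_eq_mul]
        ring
    _ = 0 := by
        refine Finset.sum_eq_zero fun ψ _ => ?_
        -- By orthogonality only the characters `ψ` that restrict to `χ` contribute, and for these
        -- `pull ψ g` inherits the depth of `χ`.
        by_cases h : ∀ v, χ v = ψ (q ≫ v ≫ g)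
        · rw [hf ψ (hχ.of_comp_left q (pull ψ g) fun v => by simp [h]), mul_zero, mul_zero]
        · refine mul_eq_zero_of_left ?_ _
          have h' := AddChar.sum_eq_ite
            (χ * ((pull ψ g).compAddMonoidHom (Preadditive.leftComp P q))⁻¹)
          rw [if_neg] at h'
          · simpa [Preadditive.leftComp] using h'
          · intro h0
            refine h fun v => ?_
            rw [← AddChar.one_eq_zero, mul_inv_eq_one] at h0
            simpa [Preadditive.leftComp] using DFunLike.congr_fun h0 v

end Restriction

/-! ### From vanishing for `F` to vanishing for all `δ̄_a τ_x F`. -/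

section Recursion

variable {k : Type w} [Field k] {C : Type u} [Category.{v} C] [Preadditive C]
  [∀ x y : C, Fintype (x ⟶ y)] {K : Type w} [Field K]

lemma card_subgroup_ne_zero {G : Type*} [Group G] (hG : (Nat.card G : K) ≠ 0)
    (H : Subgroup G) : (Nat.card H : K) ≠ 0 := by
  obtain ⟨m, hm⟩ := H.card_subgroup_dvd_card
  rw [hm, Nat.cast_mul] at hG
  exact left_ne_zero_of_mul hG

/-- The characters of `Hom(y, a)` generated by a character of `Hom(y, P)`. -/
def pullSubgroup {y P : C} (χ : AddChar (y ⟶ P) K) (a : C) : Subgroup (AddChar (y ⟶ a) K) where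
  carrier := {θ | ∃ u : a ⟶ P, θ = pull χ u}
  one_mem' := ⟨0, by ext v; simp⟩
  mul_mem' := by
    rintro _ _ ⟨u, rfl⟩ ⟨u', rfl⟩
    exact ⟨u + u', (pull_add χ u u').symm⟩
  inv_mem' := by
    rintro _ ⟨u, rfl⟩
    exact ⟨-u, by ext v; simp⟩

/-- A function on `Hom(Y, Q)` that is invariant under the shears `a ⟶ P` of `Q` and supported on
morphisms with non-zero component at `a` has vanishing Fourier coefficient at every character of
depth `r` on `P`, if it does at the characters of depth `r + 1`. -/
lemma sum_mul_eq_zero_of_shear_invariant [IsAlgClosed K]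
    (hK : ∀ x y : C, (Nat.card (x ⟶ y) : K) ≠ 0) {r : ℕ} {Y a P Q : C}
    (e : a ⟶ Q) (g : P ⟶ Q) (p : Q ⟶ a) (hep : e ≫ p = 𝟙 a) (hgp : g ≫ p = 0)
    (f : (Y ⟶ Q) → K)
    (hf : ∀ ψ : AddChar (Y ⟶ Q) K, Deep (r + 1) ψ → ∑ w, ψ w * f w = 0)
    (hs : ∀ (u : a ⟶ P) w, f (w + w ≫ p ≫ u ≫ g) = f w)
    (h0 : ∀ w, w ≫ p = 0 → f w = 0)
    (ψ : AddChar (Y ⟶ Q) K) (hψ : Deep r (pull ψ g)) : ∑ w, ψ w * f w = 0 := by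
  classical
  -- Either the summand `a` adds a strict step, so `ψ` has depth `r + 1`, or an averaging argument
  -- over twists of `ψ` along `p` is needed.
  by_cases hj : ∀ u : a ⟶ P, pull ψ e ≠ pull ψ (u ≫ g)
  · exact hf ψ (.succ ψ g e hψ hj)
  obtain ⟨u₀, hu₀⟩ : ∃ u : a ⟶ P, pull ψ e = pull ψ (u ≫ g) := by simpa using hj
  have hinv (u : a ⟶ P) : ∑ w, ψ (w ≫ p ≫ u ≫ g) * ψ w * f w = ∑ w, ψ w * f w := by
    have hc (w : Y ⟶ Q) (s t : a ⟶ P) : (w + w ≫ p ≫ s ≫ g) ≫ p ≫ t ≫ g = w ≫ p ≫ t ≫ g := by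
      simp [reassoc_of% hgp]
    refine Fintype.sum_equiv ⟨fun w => w + w ≫ p ≫ u ≫ g, fun w => w + w ≫ p ≫ (-u) ≫ g,
      fun w => ?_, fun w => ?_⟩ _ _ fun w => ?_
    · simp only [hc]; simp
    · simp only [hc]; simp
    · simp only [Equiv.coe_fn_mk, hs, AddChar.map_add_eq_mul]
      ring
  -- Summing over all twists `θ` concentrates on `w ≫ p = 0`, where `f` vanishes.
  have hsum : ∑ θ : AddChar (Y ⟶ a) K, ∑ w, θ (w ≫ p) * ψ w * f w = 0 := by
    rw [Finset.sum_comm]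
    refine Finset.sum_eq_zero fun w _ => ?_
    simp only [mul_assoc]
    rw [← Finset.sum_mul]
    by_cases hw : w ≫ p = 0
    · rw [h0 w hw, mul_zero, mul_zero]
    · rw [sum_addChar_apply_eq_zero (hK Y a) hw, zero_mul]
  let T := pullSubgroup (pull ψ g) a
  -- Twists in `T` do not change the coefficient, by shear invariance. Any other twist keeps the
  -- restriction to `P` but makes the step at `a` strict, so its depth is `r + 1`. Hence the sum is
  -- `|T|` times the wanted coefficient.
  have hT (θ : AddChar (Y ⟶ a) K) : ∑ w, θ (w ≫ p) * ψ w * f w =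
      if θ ∈ T then ∑ w, ψ w * f w else 0 := by
    split_ifs with hθ
    · obtain ⟨u, rfl⟩ := hθ
      simpa using hinv u
    · refine hf (pull θ p * ψ) (.succ _ g e ?_ fun u hu => hθ ⟨u - u₀, ?_⟩)
      · rwa [mul_pull, ← pull_comp, hgp, show pull θ (0 : P ⟶ a) = 1 by ext v; simp, one_mul]
      · rw [mul_pull, mul_pull, hu₀, ← pull_comp, ← pull_comp, hep, Category.assoc, hgp, comp_zero,
          show pull θ (0 : a ⟶ a) = 1 by ext v; simp, one_mul] at hu
        rw [← pull_comp, Preadditive.sub_comp, sub_eq_add_neg, pull_add, ← hu]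
        ext v
        simp [AddChar.map_neg_eq_inv, (ψ.val_isUnit _).ne_zero]
  simp only [hT] at hsum
  rw [← Finset.sum_filter, Finset.sum_const, nsmul_eq_mul] at hsum
  refine (mul_eq_zero.1 hsum).resolve_left ?_
  have hc : (Nat.card (AddChar (Y ⟶ a) K) : K) ≠ 0 := by
    rw [card_addChar (hK Y a)]
    exact hK Y a
  convert card_subgroup_ne_zero hc T
  rw [Nat.card_eq_fintype_card, Fintype.card_subtype]

variable [Algebra k K] [HasBinaryBiproducts C]

/-- A functional on the quotient pulls back to a function on `Hom(x ⊕ (a ⊕ y), x ⊕ (a ⊕ P))` to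
which the shear argument applies; the required sum is its restriction to the coset of maps that are
the identity on `x` and `a`. -/
lemma FourierVanishes.deltaBar_tau [IsAlgClosed K]
    (hK : ∀ x y : C, (Nat.card (x ⟶ y) : K) ≠ 0) {r : ℕ}
    {F : C ⥤ ModuleCat.{w} k} (hF : FourierVanishes K (r + 1) F) (a x : C) :
    FourierVanishes K r ((deltaBar k a).obj ((tau k x).obj F)) := by
  intro y P χ hχ μ m
  obtain ⟨z, rfl⟩ := deltaTauProj_surjective a x F y m
  let lam : F.obj (x ⊞ (a ⊞ P)) →ₗ[k] K := μ ∘ₗ deltaTauProj a x F P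
  let f (w : x ⊞ (a ⊞ y) ⟶ x ⊞ (a ⊞ P)) : K := lam ((F.map w).hom z)
  have hψ := sum_mul_eq_zero_of_shear_invariant hK (r := r) (biprod.inl ≫ biprod.inr)
    (biprod.inr ≫ biprod.inr) (biprod.snd ≫ biprod.fst) (by simp) (by simp) f
    (fun ψ hψ => hF ψ hψ lam z) (fun u w => by
      have h : w + w ≫ (biprod.snd ≫ biprod.fst) ≫ u ≫ biprod.inr ≫ biprod.inr =
          w ≫ biprod.map (𝟙 x) (Biprod.unipotentUpper u).hom := by
        conv_lhs => rw [← Category.comp_id w, Category.assoc, ← Preadditive.comp_add]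
        congr 1
        ext <;> simp [Biprod.ofComponents]
      simp only [f]
      rw [h, ← hom_map_hom_map]
      exact congrArg μ (deltaTauProj_shear a x F u _)) (fun w hw => by
      have h : w = biprod.lift (w ≫ biprod.fst) (w ≫ biprod.snd ≫ biprod.snd) ≫
          biprod.map (𝟙 x) biprod.inr := by
        ext <;> simp [hw]
      simp only [f]
      rw [h, ← hom_map_hom_map]
      exact (congrArg μ (deltaTauProj_inr a x F _)).trans (map_zero μ))
  rw [← sum_mul_restrict_eq_zero hK (biprod.snd ≫ biprod.snd) (biprod.inr ≫ biprod.inr)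
    (biprod.map (𝟙 x) (biprod.map (𝟙 a) 0)) f hψ χ hχ]
  refine Finset.sum_congr rfl fun v _ => ?_
  rw [deltaTauProj_naturality]
  have h : biprod.map (𝟙 x) (biprod.map (𝟙 a) v) =
      (biprod.snd ≫ biprod.snd) ≫ v ≫ biprod.inr ≫ biprod.inr +
        biprod.map (𝟙 x) (biprod.map (𝟙 a) 0) := by
    ext <;> simp
  rw [h]
  rfl

end Recursion

/-! ### Reduction of iterated differences to a recursion on `δ̄_a τ_x`. -/

section Iteration

variable {k : Type w} [Field k] {C : Type u} [Category.{v} C] [Preadditive C]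
  [HasBinaryBiproducts C]

lemma deltaBar_map_epi (a : C) {F G : C ⥤ ModuleCat.{w} k} (α : F ⟶ G) [Epi α] :
    Epi ((deltaBar k a).map α) := by
  rw [NatTrans.epi_iff_epi_app]
  intro b
  rw [ModuleCat.epi_iff_surjective]
  intro m
  obtain ⟨z, rfl⟩ := deltaBarProj_surjective a G b m
  have hα : Epi (α.app (a ⊞ b)) := (NatTrans.epi_iff_epi_app α).1 inferInstance _
  obtain ⟨t, rfl⟩ := (ModuleCat.epi_iff_surjective _).1 hα z
  refine ⟨deltaBarProj a F b t, ?_⟩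
  have h : cokernel.π ((idToTauBar k a).app F) ≫ (deltaBar k a).map α =
      (tauBar k a).map α ≫ cokernel.π ((idToTauBar k a).app G) := cokernel.π_desc _ _ _
  exact congrArg (fun g => (g.app b).hom (Representation.Coinvariants.mk (shearRep F a b) t)) h

lemma deltaBarIter_map_epi (l : List C) {F G : C ⥤ ModuleCat.{w} k} (α : F ⟶ G) [Epi α] :
    Epi ((deltaBarIter k l).map α) := by
  induction l with
  | nil => assumption
  | cons a l ih => exact deltaBar_map_epi a _

lemma deltaBarIter_append_singleton (l : List C) (a : C) :
    deltaBarIter k (l ++ [a]) = deltaBar k a ⋙ deltaBarIter k l := by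
  induction l with
  | nil => rfl
  | cons b l ih =>
    change deltaBarIter k (l ++ [a]) ⋙ deltaBar k b = _
    rw [ih]
    rfl

/-- The canonical isomorphism `τ_{x ⊕ z} ≅ τ_z τ_x`. -/
noncomputable def tauTauIso (x z : C) (F : C ⥤ ModuleCat.{w} k) :
    (tau k (x ⊞ z)).obj F ≅ (tau k z).obj ((tau k x).obj F) :=
  NatIso.ofComponents (fun b => F.mapIso (biprod.associator x z b)) fun f => by
    have h {b b' : C} (f : b ⟶ b') :
        biprod.map (𝟙 (x ⊞ z)) f ≫ (biprod.associator x z b').hom =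
          (biprod.associator x z b).hom ≫ biprod.map (𝟙 x) (biprod.map (𝟙 z) f) := by
      ext <;> simp
    exact (F.map_comp _ _).symm.trans ((congrArg F.map (h f)).trans (F.map_comp _ _))

/-- The canonical epimorphism `δ̄_a τ_z ⟶ τ_z δ̄_a`. -/
lemma exists_epi_deltaBar_tau (a z : C) (F : C ⥤ ModuleCat.{w} k) :
    ∃ α : (deltaBar k a).obj ((tau k z).obj F) ⟶ (tau k z).obj ((deltaBar k a).obj F), Epi α := by
  -- `s` interchanges the summands `z` and `a`; its section `s'` gives surjectivity.
  let s (b : C) : z ⊞ (a ⊞ b) ⟶ a ⊞ (z ⊞ b) :=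
    biprod.lift (biprod.snd ≫ biprod.fst) (biprod.map (𝟙 z) biprod.snd)
  let s' (b : C) : a ⊞ (z ⊞ b) ⟶ z ⊞ (a ⊞ b) :=
    biprod.lift (biprod.snd ≫ biprod.fst) (biprod.map (𝟙 a) biprod.snd)
  have hs (b : C) : s' b ≫ s b = 𝟙 _ := by
    ext <;> simp [s, s']
  let ℓ (b : C) : F.obj (z ⊞ (a ⊞ b)) →ₗ[k] ((deltaBar k a).obj F).obj (z ⊞ b) :=
    deltaBarProj a F (z ⊞ b) ∘ₗ (F.map (s b)).hom
  have hℓ (b : C) (t) : ℓ b t = deltaBarProj a F (z ⊞ b) ((F.map (s b)).hom t) := rfl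
  have key (b : C) := exists_deltaTauProj_comp a z F b (ℓ b) (fun u t => by
      have h : biprod.map (𝟙 z) (Biprod.unipotentUpper u).hom ≫ s b =
          s b ≫ (Biprod.unipotentUpper (u ≫ biprod.inr)).hom := by
        ext <;> simp [s, Biprod.ofComponents]
      rw [hℓ, hom_map_hom_map, h, ← hom_map_hom_map, deltaBarProj_shear, hℓ]) (fun t => by
      have h : biprod.map (𝟙 z) biprod.inr ≫ s b = biprod.inr := by
        ext <;> simp [s]
      rw [hℓ, hom_map_hom_map, h, deltaBarProj_inr])
  choose μ hμ using key
  refine ⟨{ app := fun b => ModuleCat.ofHom (μ b), naturality := fun b b' g => ?_ }, ?_⟩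
  · apply ModuleCat.hom_ext
    ext m
    obtain ⟨t, rfl⟩ := deltaTauProj_surjective a z F b m
    have h : biprod.map (𝟙 z) (biprod.map (𝟙 a) g) ≫ s b' =
        s b ≫ biprod.map (𝟙 a) (biprod.map (𝟙 z) g) := by
      ext <;> simp [s]
    change μ b' ((((deltaBar k a).obj ((tau k z).obj F)).map g).hom _) =
      (((deltaBar k a).obj F).map (biprod.map (𝟙 z) g)).hom (μ b _)
    rw [deltaTauProj_naturality, hμ, hμ, hℓ, hℓ, deltaBarProj_naturality, hom_map_hom_map,
      hom_map_hom_map, h]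
  · rw [NatTrans.epi_iff_epi_app]
    intro b
    rw [ModuleCat.epi_iff_surjective]
    intro m
    obtain ⟨t, rfl⟩ := deltaBarProj_surjective a F (z ⊞ b) m
    refine ⟨deltaTauProj a z F b ((F.map (s' b)).hom t), ?_⟩
    change μ b _ = _
    rw [hμ, hℓ, hom_map_hom_map, hs, F.map_id]
    rfl

/-- A functor is a retract of its shifts, hence a quotient of them. -/
lemma exists_epi_tau (z : C) (F : C ⥤ ModuleCat.{w} k) :
    ∃ α : (tau k z).obj F ⟶ F, Epi α := by
  let α : (tau k z).obj F ⟶ F :=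
    { app := fun b => F.map biprod.snd
      naturality := fun b b' g => by
        exact (F.map_comp _ _).symm.trans
          ((congrArg F.map (biprod.map_snd (𝟙 z) g)).trans (F.map_comp _ _)) }
  have : (idToTau k z).app F ≫ α = 𝟙 F := by
    ext b : 2
    change F.map biprod.inr ≫ F.map biprod.snd = _
    rw [← F.map_comp, biprod.inr_snd, F.map_id]
    rfl
  have : SplitEpi α := ⟨(idToTau k z).app F, this⟩
  exact ⟨α, this.epi⟩

/-- The condition defining `𝓕_{r-1}(C; k)`, including the case `r = 0`. -/
def DeltaBarVanishes (r : ℕ) (F : C ⥤ ModuleCat.{w} k) : Prop :=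
  ∀ (l : List C) (x : C), l.length = r → IsZero ((deltaBarIter k l).obj ((tau k x).obj F))

lemma isInF_iff_deltaBarVanishes (d : ℕ) (F : C ⥤ ModuleCat.{w} k) :
    IsInF k C d F ↔ DeltaBarVanishes (d + 1) F := by
  refine ⟨fun h l x hl => ?_, fun h a x => h _ x (by simp)⟩
  obtain ⟨a, rfl⟩ : ∃ a : Fin (d + 1) → C, List.ofFn a = l := by
    refine ⟨fun i => l.get (i.cast hl.symm), List.ext_getElem (by simp [hl]) fun i h1 h2 => ?_⟩
    rw [List.getElem_ofFn]
    rfl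
  exact h a x

/-- The shifts inserted between differences are harmless: `τ_z δ̄_a τ_x F` is a quotient of `δ̄_a
τ_{x ⊕ z} F`, any functor is a quotient of its shifts, and `δ̄` preserves epimorphisms. -/
lemma deltaBarVanishes_succ_iff (r : ℕ) (F : C ⥤ ModuleCat.{w} k) :
    DeltaBarVanishes (r + 1) F ↔
      ∀ a x, DeltaBarVanishes r ((deltaBar k a).obj ((tau k x).obj F)) := by
  constructor
  · intro h a x l z hl
    obtain ⟨α, hα⟩ := exists_epi_deltaBar_tau a z ((tau k x).obj F)
    have h1 := h (l ++ [a]) (x ⊞ z) (by simp [hl])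
    rw [deltaBarIter_append_singleton] at h1
    have h2 := h1.of_iso ((deltaBar k a ⋙ deltaBarIter k l).mapIso (tauTauIso x z F).symm)
    have := deltaBarIter_map_epi l α
    exact IsZero.of_epi ((deltaBarIter k l).map α) h2
  · intro h l x hl
    obtain ⟨l, a, rfl⟩ : ∃ l' a, l = l' ++ [a] :=
      ⟨l.dropLast, l.getLast (by rintro rfl; simp at hl),
        (List.dropLast_append_getLast _).symm⟩
    rw [deltaBarIter_append_singleton]
    obtain ⟨α, hα⟩ := exists_epi_tau x ((deltaBar k a).obj ((tau k x).obj F))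
    have := deltaBarIter_map_epi l α
    exact IsZero.of_epi ((deltaBarIter k l).map α) (h a x l x (by simpa using hl))

lemma isZero_of_deltaBarVanishes_zero [Nonempty C] {F : C ⥤ ModuleCat.{w} k}
    (h : DeltaBarVanishes 0 F) : IsZero F := by
  obtain ⟨x⟩ := ‹Nonempty C›
  obtain ⟨α, hα⟩ := exists_epi_tau x F
  exact IsZero.of_epi α (h [] x rfl)

lemma deltaBarVanishes_zero_of_isZero {F : C ⥤ ModuleCat.{w} k} (hF : IsZero F) :
    DeltaBarVanishes 0 F := by
  intro l x hl
  obtain rfl := List.length_eq_zero_iff.1 hl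
  exact Functor.isZero _ fun b => hF.obj _

end Iteration

/-- The subcategories `𝓕_d` are described by the vanishing of Fourier coefficients. -/
lemma deltaBarVanishes_iff_fourierVanishes {k : Type w} [Field k] {C : Type u} [Category.{v} C]
    [Preadditive C] [Nonempty C] [HasBinaryBiproducts C] [∀ x y : C, Fintype (x ⟶ y)]
    {K : Type w} [Field K] [Algebra k K] [IsAlgClosed K]
    (hK : ∀ x y : C, (Nat.card (x ⟶ y) : K) ≠ 0) (r : ℕ) (F : C ⥤ ModuleCat.{w} k) :
    DeltaBarVanishes r F ↔ FourierVanishes K r F := by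
  induction r generalizing F with
  | zero => exact ⟨fun h => fourierVanishes_of_isZero 0 (isZero_of_deltaBarVanishes_zero h),
      fun h => deltaBarVanishes_zero_of_isZero (h.isZero hK)⟩
  | succ r ih =>
    simp only [deltaBarVanishes_succ_iff, ih]
    exact ⟨FourierVanishes.succ hK, fun h => h.deltaBar_tau hK⟩

end ParabolicFunctors

theorem mainTheorem12 (k : Type w) [Field k] (C : Type u) [Category.{v} C] [Preadditive C]
    [HasZeroObject C] [HasBinaryBiproducts C] [EssentiallySmall.{w} C]
    (hC : ParabolicFunctors.IsKTrivial k C) (n m : ℕ) (F G : C ⥤ ModuleCat.{w} k)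
    (hF : ParabolicFunctors.IsInF k C n F) (hG : ParabolicFunctors.IsInF k C m G) :
    ParabolicFunctors.IsInF k C (n + m) (F ⊗ G) := by
  have : Nonempty C := (HasZeroObject.zero : ∃ X : C, IsZero X).nonempty
  have (x y : C) : Finite (x ⟶ y) := hC.finite_hom x y
  have (x y : C) : Fintype (x ⟶ y) := Fintype.ofFinite _
  -- Passing to the algebraic closure supplies the roots of unity needed for Fourier inversion.
  have hK (x y : C) : (Nat.card (x ⟶ y) : AlgebraicClosure k) ≠ 0 := by
    rw [← map_natCast (algebraMap k (AlgebraicClosure k)), Ne, FaithfulSMul.algebraMap_eq_zero_iff]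
    exact (hC.isUnit_card x y).ne_zero
  rw [ParabolicFunctors.isInF_iff_deltaBarVanishes,
    ParabolicFunctors.deltaBarVanishes_iff_fourierVanishes hK] at hF hG ⊢
  exact hF.tensor hK hG
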